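/- Let $\mathcal G$ be a real Lie algebra of H-type: it carries an inner product $\langle\cdot,\cdot\rangle$ and an orthogonal decomposition $\mathcal G=V\oplus\mathcal Z$ with $[\mathcal G,\mathcal G]=[V,V]=\mathcal Z$, $[\mathcal G,\mathcal Z]=0$, such that for every unit vector $v\in V$ the map $\mathrm{ad}_v$ is an isometry of $(\ker \mathrm{ad}_v)^\perp$ onto $\mathcal Z$. Let $(X_1,\dots,X_n,Z_1,\dots,Z_m)$ be a basis of $\mathcal G$ with $X_i\in V$, $Z_\alpha\in\mathcal Z$, let $C_{ij}^{n+\alpha}$ be the structure constants, $[X_i,X_j]=\sum_{\alpha=1}^m C_{ij}^{n+\alpha}Z_\alpha$, and put $\gamma_{ij}^\alpha=-C_{ij}^{n+\alpha}$ (so $\gamma_{ij}^\alpha=-\gamma_{ji}^\alpha$). Let $G$ be the simply connected Lie group with Lie algebra $\mathcal G$, written in exponential coordinates, $(x,z)\leftrightarrow\exp(\sum_i x^iX_i+\sum_\alpha z^\alpha Z_\alpha)$; that is, $G=\mathbb R^{n}\times\mathbb R^m$ with the product $$(x,z)(x',z')=\Big(x+x',\ \Big(z^\alpha+z'^\alpha+\tfrac12\sum_{i,l=1}^n\gamma_{il}^\alpha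 x^l x'^i\Big)_{\alpha}\Big).$$ A metric (smooth, nondegenerate, symmetric, of any signature) $\mu$ on $G$ is called a Cartan–Schouten metric if $\nabla\mu=0$, where $\nabla$ is the connection on $G$ with $\nabla_{x^+}y^+=\frac12[x,y]^+$ for $x,y\in\mathcal G$ ($x^+$ is the left invariant vector field defined by $x$). Write $\theta^2=\theta\otimes\theta$ and $\theta\eta=\theta\otimes\eta+\eta\otimes\theta$ for the symmetric product of two one-forms (so $dx^i\,dx^p$ means $2\,dx^i\otimes dx^i$ when $p=i$ in the last sum of the formula below), and $\nu^\alpha=dz^\alpha-\frac12\sum_{p,l=1}^n\gamma_{pl}^\alpha x^l\,dx^p$. For a symmetric real matrix $d=(d_{ab})_{1\le a,b\le n+m}$ put $$\begin{aligned} A_{ii}&=\tfrac14\sum_{\alpha,\beta=1}^m\sum_{p,l=1}^n C_{pi}^{n+\alpha}C_{li}^{n+\beta}d_{n+\alpha,n+\beta}x^px^l+\sum_{\alpha=1}^m\sum_{l=1}^n\gamma_{il}^\alpha d_{i,n+\alpha}x^l+d_{ii},\\ A_{ij}&=\tfrac14\sum_{\alpha,\beta=1}^m\sum_{p,l=1}^n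 C_{pi}^{n+\alpha}C_{lj}^{n+\beta}d_{n+\alpha,n+\beta}x^px^l+\tfrac12\sum_{\alpha=1}^m\sum_{l=1}^n\big(C_{li}^{n+\alpha}d_{j,n+\alpha}+C_{lj}^{n+\alpha}d_{i,n+\alpha}\big)x^l+d_{ij}\quad(i<j),\\ B_{i\alpha}&=\tfrac12\sum_{\beta=1}^m\sum_{k=1}^n C_{ki}^{n+\beta}d_{n+\alpha,n+\beta}x^k+d_{i,n+\alpha}. \end{aligned}$$ Then every Cartan–Schouten metric $\mu$ on $G$ is of the form $$\begin{aligned} \mu={}&\sum_{i=1}^n A_{ii}(dx^i)^2+\sum_{\alpha=1}^m d_{n+\alpha,n+\alpha}(\nu^\alpha)^2+\sum_{1\le i<j\le n}A_{ij}\,dx^i\,dx^j\\ &+\sum_{1\le\alpha<\beta\le m}d_{n+\alpha,n+\beta}\,\nu^\alpha\nu^\beta\\ &+\sum_{i=1}^n\sum_{\alpha=1}^m B_{i\alpha}\,dx^i\,dz^\alpha-\tfrac12\sum_{i,l,p=1}^n\sum_{\alpha=1}^m B_{i\alpha}\gamma_{pl}^\alpha x^l\,dx^i\,dx^p \end{aligned}$$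 for some real symmetric matrix $d$ of constants with $\det d\ne0$; in particular the components of $\mu$ in the coordinates $(x,z)$ are polynomials of degree at most $2$ in $x$. Conversely, for every real symmetric matrix $d$ with $\det d\neq 0$ this formula defines a Cartan–Schouten metric on $G$. -/

import Mathlib

open scoped Manifold ContDiff Matrix

noncomputable section

/-! ### Pseudo-Riemannian metrics and Cartan–Schouten metrics on Lie groups -/

section General

/-- A smooth metric, of any signature, on a manifold `M`: a smooth field of nondegenerate
symmetric bilinear forms on the tangent spaces. -/
structure SmoothMetric {E : Type*} [NormedAddCommGroup E] [NormedSpace ℝ E]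
    {H : Type*} [TopologicalSpace H] (I : ModelWithCorners ℝ E H)
    (M : Type*) [TopologicalSpace M] [ChartedSpace H M] [IsManifold I ∞ M] where
  /-- The bilinear form on each tangent space. -/
  form (p : M) : TangentSpace I p →L[ℝ] TangentSpace I p →L[ℝ] ℝ
  symm (p : M) (u v : TangentSpace I p) : form p u v = form p v u
  nondegenerate (p : M) (u : TangentSpace I p) (hu : ∀ v, form p u v = 0) : u = 0
  contMDiff : ContMDiff I (I.prod 𝓘(ℝ, E →L[ℝ] E →L[ℝ] ℝ)) ∞
    (fun p ↦ Bundle.TotalSpace.mk' (E →L[ℝ] E →L[ℝ] ℝ)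
      (E := fun q : M ↦ TangentSpace I q →L[ℝ] TangentSpace I q →L[ℝ] ℝ) p (form p))

/-- `∇ μ = 0`: one has `v · μ(Y, Z) = μ(∇_v Y, Z) + μ(Y, ∇_v Z)` for all smooth vector fields
`Y`, `Z` and every tangent vector `v`. -/
def SmoothMetric.IsParallel {E : Type*} [NormedAddCommGroup E] [NormedSpace ℝ E]
    {H : Type*} [TopologicalSpace H] {I : ModelWithCorners ℝ E H}
    {M : Type*} [TopologicalSpace M] [ChartedSpace H M] [IsManifold I ∞ M]
    (μ : SmoothMetric I M)
    (cov : CovariantDerivative I E (fun p : M ↦ TangentSpace I p)) : Prop :=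
  ∀ Y Z : (p : M) → TangentSpace I p,
    ContMDiff I I.tangent ∞ (fun p ↦ (⟨p, Y p⟩ : TangentBundle I M)) →
    ContMDiff I I.tangent ∞ (fun p ↦ (⟨p, Z p⟩ : TangentBundle I M)) →
    ∀ (p : M) (v : TangentSpace I p),
      mfderiv I 𝓘(ℝ, ℝ) (fun q ↦ μ.form q (Y q) (Z q)) p v =
        μ.form p (cov Y p v) (Z p) + μ.form p (Y p) (cov Z p v)

/-- The canonical (bi-invariant, torsion free) Cartan–Schouten connection of a Lie group: the
affine connection with `∇_{x⁺} y⁺ = ½ [x, y]⁺` for all `x`, `y` in the Lie algebra, where `x⁺` is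
the left invariant vector field with value `x` at the unit. -/
def IsCartanSchoutenConnection {E : Type*} [NormedAddCommGroup E] [NormedSpace ℝ E]
    {H : Type*} [TopologicalSpace H] {I : ModelWithCorners ℝ E H}
    {G : Type*} [TopologicalSpace G] [ChartedSpace H G] [Group G] [LieGroup I ∞ G]
    (cov : CovariantDerivative I E (fun g : G ↦ TangentSpace I g)) : Prop :=
  ∀ (x y : GroupLieAlgebra I G) (g : G),
    cov (mulInvariantVectorField y) g (mulInvariantVectorField x g) =
      (1 / 2 : ℝ) • mulInvariantVectorField (⁅x, y⁆ : GroupLieAlgebra I G) g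

/-- A Cartan–Schouten metric on a Lie group is a metric which is parallel with respect to the
canonical Cartan–Schouten connection. -/
def SmoothMetric.IsCartanSchouten {E : Type*} [NormedAddCommGroup E] [NormedSpace ℝ E]
    {H : Type*} [TopologicalSpace H] {I : ModelWithCorners ℝ E H}
    {G : Type*} [TopologicalSpace G] [ChartedSpace H G] [Group G] [LieGroup I ∞ G] (μ : SmoothMetric I G) : Prop :=
  ∃ cov : CovariantDerivative I E (fun g : G ↦ TangentSpace I g),
    IsCartanSchoutenConnection cov ∧ μ.IsParallel cov

end General

/-! ### Lie algebras of H-type -/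

/-- `𝔤 = V ⊕ Z` is a Lie algebra of H-type for the inner product `B`: `[𝔤, 𝔤] = [V, V] = Z`,
`[𝔤, Z] = 0`, `V ⊥ Z`, and, for every unit vector `v` of `V`, the map `ad v` is an isometry from
the orthogonal complement of its kernel onto `Z`. -/
structure IsHType {𝔤 : Type*} [LieRing 𝔤] [LieAlgebra ℝ 𝔤]
    (B : LinearMap.BilinForm ℝ 𝔤) (V Z : Submodule ℝ 𝔤) : Prop where
  symm (u v : 𝔤) : B u v = B v u
  pos (u : 𝔤) (hu : u ≠ 0) : 0 < B u u
  isCompl : IsCompl V Z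
  orthogonal (v : 𝔤) (hv : v ∈ V) (z : 𝔤) (hz : z ∈ Z) : B v z = 0
  span_lie : Submodule.span ℝ {x : 𝔤 | ∃ u w : 𝔤, ⁅u, w⁆ = x} = Z
  span_lie_V : Submodule.span ℝ {x : 𝔤 | ∃ u ∈ V, ∃ w ∈ V, ⁅u, w⁆ = x} = Z
  central (u : 𝔤) (z : 𝔤) (hz : z ∈ Z) : ⁅u, z⁆ = 0
  isometry (v : 𝔤) (hv : v ∈ V) (hv1 : B v v = 1) (w : 𝔤)
    (hw : ∀ k : 𝔤, ⁅v, k⁆ = 0 → B k w = 0) : B ⁅v, w⁆ ⁅v, w⁆ = B w w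
  onto (v : 𝔤) (hv : v ∈ V) (hv1 : B v v = 1) (z : 𝔤) (hz : z ∈ Z) :
    ∃ w : 𝔤, (∀ k : 𝔤, ⁅v, k⁆ = 0 → B k w = 0) ∧ ⁅v, w⁆ = z

/-- The structure constants `C i j k` of a Lie algebra in a basis `(X_1, …, X_n, Z_1, …, Z_m)`:
the coefficient of `Z_k` in `[X_i, X_j]`. -/
def structConst {𝔤 : Type*} [LieRing 𝔤] [LieAlgebra ℝ 𝔤] {n m : ℕ}
    (b : Module.Basis (Fin n ⊕ Fin m) ℝ 𝔤) (i j : Fin n) (k : Fin m) : ℝ :=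
  b.repr ⁅b (Sum.inl i), b (Sum.inl j)⁆ (Sum.inr k)

/-- The matrices `γ^k = (γ_{ij}^k)`, with `γ_{ij}^k = - C_{ij}^k`. -/
def gammaMat {𝔤 : Type*} [LieRing 𝔤] [LieAlgebra ℝ 𝔤] {n m : ℕ}
    (b : Module.Basis (Fin n ⊕ Fin m) ℝ 𝔤) (k : Fin m) : Matrix (Fin n) (Fin n) ℝ :=
  Matrix.of fun i j ↦ -structConst b i j k

/-! ### The group in exponential coordinates -/

/-- The coordinate space `ℝⁿ × ℝᵐ`. -/
abbrev CoordSpace (n m : ℕ) : Type := (Fin n → ℝ) × (Fin m → ℝ)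

/-- The simply connected step-two group with parameter `γ`, in exponential coordinates: the
manifold `ℝⁿ × ℝᵐ` with the product
`(x, z) (x', z') = (x + x', z + z' + ½ ⟨γ x, x'⟩)`, where
`⟨γ^k x, x'⟩ = ∑ i, ∑ l, γ_{il}^k x_l x'_i`. -/
def ExpGroup {n m : ℕ} (_γ : Fin m → Matrix (Fin n) (Fin n) ℝ) : Type := CoordSpace n m

namespace ExpGroup

variable {n m : ℕ} {γ : Fin m → Matrix (Fin n) (Fin n) ℝ}

/-- The point with given coordinates. -/
def mk (γ : Fin m → Matrix (Fin n) (Fin n) ℝ) (s : CoordSpace n m) : ExpGroup γ := s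

/-- The coordinates `(x, z)` of a point. -/
def coord (p : ExpGroup γ) : CoordSpace n m := p

instance : TopologicalSpace (ExpGroup γ) := inferInstanceAs (TopologicalSpace (CoordSpace n m))

instance : ChartedSpace (CoordSpace n m) (ExpGroup γ) :=
  inferInstanceAs (ChartedSpace (CoordSpace n m) (CoordSpace n m))

instance : IsManifold 𝓘(ℝ, CoordSpace n m) ∞ (ExpGroup γ) :=
  inferInstanceAs (IsManifold 𝓘(ℝ, CoordSpace n m) ∞ (CoordSpace n m))

/-- The vector `(⟨γ^k x, x'⟩)_k`. -/
def pairing (γ : Fin m → Matrix (Fin n) (Fin n) ℝ) (x x' : Fin n → ℝ) : Fin m → ℝ :=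
  fun k ↦ ∑ i, ∑ l, γ k i l * x l * x' i

instance : Mul (ExpGroup γ) :=
  ⟨fun p q ↦ mk γ (p.coord.1 + q.coord.1,
    p.coord.2 + q.coord.2 + (1 / 2 : ℝ) • pairing γ p.coord.1 q.coord.1)⟩

instance : One (ExpGroup γ) := ⟨mk γ (0, 0)⟩

instance : Inv (ExpGroup γ) :=
  ⟨fun p ↦ mk γ (-p.coord.1, -p.coord.2 + (1 / 2 : ℝ) • pairing γ p.coord.1 p.coord.1)⟩

theorem coord_mul (p q : ExpGroup γ) : (p * q).coord = (p.coord.1 + q.coord.1,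
    p.coord.2 + q.coord.2 + (1 / 2 : ℝ) • pairing γ p.coord.1 q.coord.1) := rfl

theorem coord_one : (1 : ExpGroup γ).coord = (0, 0) := rfl

theorem coord_inv (p : ExpGroup γ) : (p⁻¹).coord =
    (-p.coord.1, -p.coord.2 + (1 / 2 : ℝ) • pairing γ p.coord.1 p.coord.1) := rfl

theorem pairing_add_left (x y w : Fin n → ℝ) :
    pairing γ (x + y) w = pairing γ x w + pairing γ y w := by
  ext k
  simp only [pairing, Pi.add_apply, ← Finset.sum_add_distrib]
  exact Finset.sum_congr rfl fun i _ ↦ Finset.sum_congr rfl fun l _ ↦ by ring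

theorem pairing_add_right (x y w : Fin n → ℝ) :
    pairing γ x (y + w) = pairing γ x y + pairing γ x w := by
  ext k
  simp only [pairing, Pi.add_apply, ← Finset.sum_add_distrib]
  exact Finset.sum_congr rfl fun i _ ↦ Finset.sum_congr rfl fun l _ ↦ by ring

theorem pairing_smul_left (c : ℝ) (x y : Fin n → ℝ) :
    pairing γ (c • x) y = c • pairing γ x y := by
  ext k
  simp only [pairing, Pi.smul_apply, smul_eq_mul, Finset.mul_sum]
  exact Finset.sum_congr rfl fun i _ ↦ Finset.sum_congr rfl fun l _ ↦ by ring

theorem pairing_smul_right (c : ℝ) (x y : Fin n → ℝ) :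
    pairing γ x (c • y) = c • pairing γ x y := by
  ext k
  simp only [pairing, Pi.smul_apply, smul_eq_mul, Finset.mul_sum]
  exact Finset.sum_congr rfl fun i _ ↦ Finset.sum_congr rfl fun l _ ↦ by ring

theorem ext_coord {p q : ExpGroup γ} (h : p.coord = q.coord) : p = q := h

instance : Group (ExpGroup γ) :=
  Group.ofLeftAxioms
    (by
      intro p q r
      apply ext_coord
      simp only [coord_mul, pairing_add_left, pairing_add_right, smul_add]
      refine Prod.ext ?_ ?_
      · exact add_assoc _ _ _
      · simp only
        abel)
    (by
      intro p
      apply ext_coord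
      have h0 : pairing γ 0 p.coord.1 = 0 := by
        simpa using pairing_smul_left (γ := γ) 0 0 p.coord.1
      simp [coord_mul, coord_one, h0])
    (by
      intro p
      apply ext_coord
      have h0 : pairing γ (-p.coord.1) p.coord.1 = -pairing γ p.coord.1 p.coord.1 := by
        simpa using pairing_smul_left (γ := γ) (-1) p.coord.1 p.coord.1
      simp [coord_mul, coord_one, coord_inv, h0])

theorem contDiff_pairing :
    ContDiff ℝ ∞ (fun w : (Fin n → ℝ) × (Fin n → ℝ) ↦ pairing γ w.1 w.2) := by
  unfold pairing
  fun_prop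

instance : LieGroup 𝓘(ℝ, CoordSpace n m) ∞ (ExpGroup γ) where
  contMDiff_mul := by
    have h : ContDiff ℝ ∞ (fun w : CoordSpace n m × CoordSpace n m ↦
        ((w.1.1 + w.2.1, w.1.2 + w.2.2 + (1 / 2 : ℝ) • pairing γ w.1.1 w.2.1) :
          CoordSpace n m)) := by
      unfold pairing
      fun_prop
    have h2 := h.contMDiff
    rw [modelWithCornersSelf_prod, ← chartedSpaceSelf_prod] at h2
    exact h2
  contMDiff_inv := by
    have h : ContDiff ℝ ∞ (fun w : CoordSpace n m ↦
        ((-w.1, -w.2 + (1 / 2 : ℝ) • pairing γ w.1 w.1) : CoordSpace n m)) := by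
      unfold pairing
      fun_prop
    exact h.contMDiff

/-- For skew-symmetric `γ^k` the coordinates are exponential: the lines through the origin are
one-parameter subgroups. -/
theorem mk_add_smul (hγ : ∀ k, (γ k)ᵀ = -γ k) (s : CoordSpace n m) (t t' : ℝ) :
    mk γ ((t + t') • s) = mk γ (t • s) * mk γ (t' • s) := by
  have h0 : pairing γ s.1 s.1 = 0 := by
    ext k
    have h1 : pairing γ s.1 s.1 k = -pairing γ s.1 s.1 k := by
      conv_lhs => rw [pairing, Finset.sum_comm]
      rw [pairing, ← Finset.sum_neg_distrib]
      refine Finset.sum_congr rfl fun i _ ↦ ?_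
      rw [← Finset.sum_neg_distrib]
      refine Finset.sum_congr rfl fun l _ ↦ ?_
      have := congrFun (congrFun (hγ k) i) l
      simp only [Matrix.transpose_apply, Matrix.neg_apply] at this
      rw [this]; ring
    simpa using (by linarith : pairing γ s.1 s.1 k = 0)
  apply ext_coord
  rw [coord_mul]
  refine Prod.ext ?_ ?_
  · simp [mk, coord, add_smul]
  · simp [mk, coord, pairing_smul_left, pairing_smul_right, h0, add_smul]

theorem contDiff_leftMul (p : CoordSpace n m) :
    ContDiff ℝ ∞ (fun q : CoordSpace n m ↦
      ((p.1 + q.1, p.2 + q.2 + (1 / 2 : ℝ) • pairing γ p.1 q.1) : CoordSpace n m)) := by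
  unfold pairing
  fun_prop

/-- The left invariant vector field `u⁺` in coordinates. -/
theorem mulInvariantVectorField_eq (u : CoordSpace n m) (p : ExpGroup γ) :
    (mulInvariantVectorField (I := 𝓘(ℝ, CoordSpace n m)) (G := ExpGroup γ) u p :
      CoordSpace n m) = (u.1, u.2 + (1 / 2 : ℝ) • pairing γ p.coord.1 u.1) := by
  let f : CoordSpace n m → CoordSpace n m := fun q ↦
    (p.coord.1 + q.1, p.coord.2 + q.2 + (1 / 2 : ℝ) • pairing γ p.coord.1 q.1)
  have h1 : (mulInvariantVectorField (I := 𝓘(ℝ, CoordSpace n m)) (G := ExpGroup γ) u p :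
      CoordSpace n m) = mfderiv 𝓘(ℝ, CoordSpace n m) 𝓘(ℝ, CoordSpace n m) f 0 u := rfl
  have hf : DifferentiableAt ℝ f 0 :=
    ((contDiff_leftMul (γ := γ) p.coord).differentiable (by simp)).differentiableAt
  rw [h1, mfderiv_eq_fderiv]
  change fderiv ℝ f 0 u = _
  rw [← hf.lineDeriv_eq_fderiv]
  apply HasLineDerivAt.lineDeriv
  have h2 : ∀ t : ℝ, f (0 + t • u) = p.coord +
      t • ((u.1, u.2 + (1 / 2 : ℝ) • pairing γ p.coord.1 u.1) : CoordSpace n m) := by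
    intro t
    refine Prod.ext ?_ ?_
    · simp [f]
    · simp only [f, zero_add, Prod.smul_fst, Prod.smul_snd, pairing_smul_right, Prod.snd_add,
        smul_add, add_assoc, smul_comm t (1 / 2 : ℝ)]
  unfold HasLineDerivAt
  simp only [h2]
  simpa using ((hasDerivAt_id (0 : ℝ)).smul_const
    ((u.1, u.2 + (1 / 2 : ℝ) • pairing γ p.coord.1 u.1) : CoordSpace n m)).const_add p.coord

/-- The coordinates of a tangent vector. -/
def tcoord {p : ExpGroup γ} (u : TangentSpace 𝓘(ℝ, CoordSpace n m) p) : CoordSpace n m := u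

/-- The Lie bracket of the Lie algebra of the group, in coordinates. -/
theorem bracket_eq (u w : GroupLieAlgebra 𝓘(ℝ, CoordSpace n m) (ExpGroup γ)) :
    tcoord ⁅u, w⁆ = (0, (1 / 2 : ℝ) • (pairing γ (tcoord u).1 (tcoord w).1 -
      pairing γ (tcoord w).1 (tcoord u).1)) := by
  let F : CoordSpace n m → CoordSpace n m → CoordSpace n m := fun u p ↦
    (u.1, u.2 + (1 / 2 : ℝ) • pairing γ p.1 u.1)
  have hF : ∀ u : CoordSpace n m,
      (mulInvariantVectorField (I := 𝓘(ℝ, CoordSpace n m)) (G := ExpGroup γ) u :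
        CoordSpace n m → CoordSpace n m) = F u := fun u ↦
    funext fun p ↦ mulInvariantVectorField_eq u p
  have hdiff : ∀ u : CoordSpace n m, ContDiff ℝ ∞ (F u) := by
    intro u
    simp only [F]
    unfold pairing
    fun_prop
  have hpz : ∀ u : Fin n → ℝ, pairing γ 0 u = 0 := fun u ↦ by
    simpa using pairing_smul_left (γ := γ) 0 0 u
  have hD : ∀ u v : CoordSpace n m, fderiv ℝ (F u) 0 v =
      (0, (1 / 2 : ℝ) • pairing γ v.1 u.1) := by
    intro u v
    have hf : DifferentiableAt ℝ (F u) 0 :=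
      ((hdiff u).differentiable (by simp)).differentiableAt
    rw [← hf.lineDeriv_eq_fderiv]
    apply HasLineDerivAt.lineDeriv
    have h2 : ∀ t : ℝ, F u (0 + t • v) = u +
        t • ((0, (1 / 2 : ℝ) • pairing γ v.1 u.1) : CoordSpace n m) := by
      intro t
      refine Prod.ext ?_ ?_
      · simp [F]
      · simp only [F, zero_add, Prod.smul_fst, Prod.smul_snd, pairing_smul_left, Prod.snd_add,
          smul_comm t (1 / 2 : ℝ)]
    unfold HasLineDerivAt
    simp only [h2]
    simpa using ((hasDerivAt_id (0 : ℝ)).smul_const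
      ((0, (1 / 2 : ℝ) • pairing γ v.1 u.1) : CoordSpace n m)).const_add u
  let P : CoordSpace n m → CoordSpace n m :=
    mulInvariantVectorField (I := 𝓘(ℝ, CoordSpace n m)) (G := ExpGroup γ) u
  let Q : CoordSpace n m → CoordSpace n m :=
    mulInvariantVectorField (I := 𝓘(ℝ, CoordSpace n m)) (G := ExpGroup γ) w
  have h0 : VectorField.mlieBracketWithin 𝓘(ℝ, CoordSpace n m) (M := CoordSpace n m)
      P Q Set.univ 0 = tcoord ⁅u, w⁆ :=
    congrFun (VectorField.mlieBracketWithin_univ (I := 𝓘(ℝ, CoordSpace n m))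
      (M := CoordSpace n m) (V := P) (W := Q)) 0
  have h1 : tcoord ⁅u, w⁆ = VectorField.lieBracketWithin ℝ P Q Set.univ 0 :=
    h0.symm.trans (congrFun (VectorField.mlieBracketWithin_eq_lieBracketWithin (𝕜 := ℝ)
      (E := CoordSpace n m) (V := P) (W := Q) (s := Set.univ)) 0)
  have h2 : tcoord ⁅u, w⁆ =
      VectorField.lieBracketWithin ℝ (F (tcoord u)) (F (tcoord w)) Set.univ 0 :=
    h1.trans (congrArg₂ (fun P Q : CoordSpace n m → CoordSpace n m ↦
      VectorField.lieBracketWithin ℝ P Q Set.univ 0) (hF u) (hF w))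
  rw [h2, VectorField.lieBracketWithin_univ, VectorField.lieBracket, hD, hD]
  refine Prod.ext ?_ ?_
  · simp
  · simp [F, smul_sub]

/-- The coordinates `(x, z)` of an element `∑ x_i X_i + ∑ z_k Z_k` of the Lie algebra, as a
tangent vector at the unit of the group. -/
def ofLie {𝔤 : Type*} [LieRing 𝔤] [LieAlgebra ℝ 𝔤] (b : Module.Basis (Fin n ⊕ Fin m) ℝ 𝔤)
    (u : 𝔤) : GroupLieAlgebra 𝓘(ℝ, CoordSpace n m) (ExpGroup (gammaMat b)) :=
  ((fun i ↦ b.repr u (Sum.inl i), fun k ↦ b.repr u (Sum.inr k)) : CoordSpace n m)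

/-- For an adapted basis of a Lie algebra of H-type, the Lie algebra of the group is the given
Lie algebra, the basis being sent to the coordinate basis. -/
theorem ofLie_lie {𝔤 : Type*} [LieRing 𝔤] [LieAlgebra ℝ 𝔤] {B : LinearMap.BilinForm ℝ 𝔤}
    {V Z : Submodule ℝ 𝔤} (hH : IsHType B V Z) (b : Module.Basis (Fin n ⊕ Fin m) ℝ 𝔤)
    (hV : ∀ i, b (Sum.inl i) ∈ V) (hZ : ∀ k, b (Sum.inr k) ∈ Z) (u w : 𝔤) :
    ofLie b ⁅u, w⁆ = ⁅ofLie b u, ofLie b w⁆ := by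
  have hcoordZ : ∀ z ∈ Z, ∀ i, b.repr z (Sum.inl i) = 0 := by
    intro z hz i
    have h1 : ∑ j, b.repr z (Sum.inl j) • b (Sum.inl j) = 0 := by
      have h2 : z = ∑ j, b.repr z (Sum.inl j) • b (Sum.inl j) +
          ∑ k, b.repr z (Sum.inr k) • b (Sum.inr k) := by
        rw [← Fintype.sum_sum_type (fun a ↦ b.repr z a • b a), b.sum_repr]
      refine (Submodule.disjoint_def.1 hH.isCompl.disjoint) _
        (V.sum_mem fun j _ ↦ V.smul_mem _ (hV j)) ?_
      have h3 : ∑ j, b.repr z (Sum.inl j) • b (Sum.inl j) =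
          z - ∑ k, b.repr z (Sum.inr k) • b (Sum.inr k) := by
        nth_rewrite 2 [h2]; abel
      rw [h3]
      exact Z.sub_mem hz (Z.sum_mem fun k _ ↦ Z.smul_mem _ (hZ k))
    have h4 : LinearIndependent ℝ (b ∘ Sum.inl) :=
      b.linearIndependent.comp _ Sum.inl_injective
    exact Fintype.linearIndependent_iff.1 h4 _ h1 i
  have hmem : ∀ u w : 𝔤, ⁅u, w⁆ ∈ Z := fun u w ↦ by
    rw [← hH.span_lie]; exact Submodule.subset_span ⟨u, w, rfl⟩
  have hexp : ∀ u w : 𝔤, ∀ k, b.repr ⁅u, w⁆ (Sum.inr k) =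
      ∑ i, ∑ l, structConst b l i k * b.repr u (Sum.inl l) * b.repr w (Sum.inl i) := by
    intro u w k
    have hleft : ∀ x y z : 𝔤, z ∈ Z → ⁅x + z, y⁆ = ⁅x, y⁆ := fun x y z hz ↦ by
      rw [add_lie, ← lie_skew z y, hH.central y z hz]; simp
    have hright : ∀ x y z : 𝔤, z ∈ Z → ⁅x, y + z⁆ = ⁅x, y⁆ := fun x y z hz ↦ by
      rw [lie_add, hH.central x z hz]; simp
    have hdec : ∀ u : 𝔤, u = ∑ j, b.repr u (Sum.inl j) • b (Sum.inl j) +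
        ∑ k, b.repr u (Sum.inr k) • b (Sum.inr k) := fun u ↦ by
      rw [← Fintype.sum_sum_type (fun a ↦ b.repr u a • b a), b.sum_repr]
    have hz : ∀ u : 𝔤, ∑ k, b.repr u (Sum.inr k) • b (Sum.inr k) ∈ Z := fun u ↦
      Z.sum_mem fun k _ ↦ Z.smul_mem _ (hZ k)
    have h5 : ⁅u, w⁆ = ⁅∑ l, b.repr u (Sum.inl l) • b (Sum.inl l),
        ∑ i, b.repr w (Sum.inl i) • b (Sum.inl i)⁆ := by
      conv_lhs => rw [hdec u, hdec w]
      rw [hleft _ _ _ (hz u), hright _ _ _ (hz w)]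
    rw [h5]
    simp only [sum_lie, lie_sum, smul_lie, lie_smul, map_sum, map_smul,
      Finsupp.coe_finsetSum, Finset.sum_apply, Finsupp.smul_apply, smul_eq_mul, structConst]
    refine Finset.sum_congr rfl fun i _ ↦ ?_
    rw [Finset.mul_sum]
    exact Finset.sum_congr rfl fun l _ ↦ by ring
  have hpair : ∀ u w : 𝔤, pairing (gammaMat b) (tcoord (ofLie b u)).1 (tcoord (ofLie b w)).1 =
      fun k ↦ b.repr ⁅u, w⁆ (Sum.inr k) := by
    intro u w
    ext k
    rw [hexp]
    refine Finset.sum_congr rfl fun i _ ↦ Finset.sum_congr rfl fun l _ ↦ ?_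
    have h6 : structConst b l i k = -structConst b i l k := by
      unfold structConst
      rw [← lie_skew (b (Sum.inl l)) (b (Sum.inl i)), map_neg, Finsupp.neg_apply]
    simp [gammaMat, h6, ofLie, tcoord]
  have hmain : tcoord (ofLie b ⁅u, w⁆) = tcoord ⁅ofLie b u, ofLie b w⁆ := by
    rw [bracket_eq, hpair, hpair]
    refine Prod.ext ?_ ?_
    · ext i
      exact hcoordZ _ (hmem u w) i
    · ext k
      have h7 : b.repr ⁅w, u⁆ (Sum.inr k) = -b.repr ⁅u, w⁆ (Sum.inr k) := by
        rw [← lie_skew w u, map_neg, Finsupp.neg_apply]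
      simp only [ofLie, tcoord, Pi.smul_apply, Pi.sub_apply, h7, smul_eq_mul]
      ring
  exact hmain

end ExpGroup

/-! ### The explicit form of the metrics

Here `C` stands for structure constants, `γ` for the matrices `γ^α`, and the rows and columns of
`d` are indexed by `1, …, n` (`Sum.inl`) and `n + 1, …, n + m` (`Sum.inr`). -/

section ExplicitForm

variable {n m : ℕ}

/-- The coefficient of `(dx^i)²`. -/
def coefDiag (C : Fin n → Fin n → Fin m → ℝ) (γ : Fin m → Matrix (Fin n) (Fin n) ℝ)
    (d : Matrix (Fin n ⊕ Fin m) (Fin n ⊕ Fin m) ℝ) (x : Fin n → ℝ) (i : Fin n) : ℝ :=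
  (1 / 4) * ∑ α, ∑ β, ∑ p, ∑ l, C p i α * C l i β * d (Sum.inr α) (Sum.inr β) * x p * x l
    + ∑ α, ∑ l, γ α i l * d (Sum.inl i) (Sum.inr α) * x l
    + d (Sum.inl i) (Sum.inl i)

/-- The coefficient of `dx^i dx^j`, for `i < j`. -/
def coefXX (C : Fin n → Fin n → Fin m → ℝ)
    (d : Matrix (Fin n ⊕ Fin m) (Fin n ⊕ Fin m) ℝ) (x : Fin n → ℝ) (i j : Fin n) : ℝ :=
  (1 / 4) * ∑ α, ∑ β, ∑ p, ∑ l, C p i α * C l j β * d (Sum.inr α) (Sum.inr β) * x p * x l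
    + (1 / 2) * ∑ α, ∑ l,
        (C l i α * d (Sum.inl j) (Sum.inr α) + C l j α * d (Sum.inl i) (Sum.inr α)) * x l
    + d (Sum.inl i) (Sum.inl j)

/-- The coefficient of `dx^i dz^α`. -/
def coefXZ (C : Fin n → Fin n → Fin m → ℝ)
    (d : Matrix (Fin n ⊕ Fin m) (Fin n ⊕ Fin m) ℝ) (x : Fin n → ℝ) (i : Fin n) (α : Fin m) : ℝ :=
  (1 / 2) * ∑ β, ∑ k, C k i β * d (Sum.inr α) (Sum.inr β) * x k + d (Sum.inl i) (Sum.inr α)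

/-- The coordinate one-form `dx^i`. -/
def dx (i : Fin n) (u : CoordSpace n m) : ℝ := u.1 i

/-- The coordinate one-form `dz^α`. -/
def dz (α : Fin m) (u : CoordSpace n m) : ℝ := u.2 α

/-- The one-form `dz^α - ½ ∑_{p, l} γ_{pl}^α x^l dx^p`, at a point with first coordinates `x`. -/
def nuForm (γ : Fin m → Matrix (Fin n) (Fin n) ℝ) (x : Fin n → ℝ) (α : Fin m)
    (u : CoordSpace n m) : ℝ :=
  dz α u - (1 / 2) * ∑ p, ∑ l, γ α p l * x l * dx p u

/-- The square `θ² = θ ⊗ θ` of a one-form, at the pair `(u, w)`. -/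
def sqForm (θ : CoordSpace n m → ℝ) (u w : CoordSpace n m) : ℝ := θ u * θ w

/-- The symmetric product `θ η = θ ⊗ η + η ⊗ θ` of two one-forms, at the pair `(u, w)`. -/
def symProd (θ η : CoordSpace n m → ℝ) (u w : CoordSpace n m) : ℝ := θ u * η w + η u * θ w

/-- The explicit bilinear form with constants `d`, at a point with first coordinates `x`. -/
def explicitForm (C : Fin n → Fin n → Fin m → ℝ) (γ : Fin m → Matrix (Fin n) (Fin n) ℝ)
    (d : Matrix (Fin n ⊕ Fin m) (Fin n ⊕ Fin m) ℝ) (x : Fin n → ℝ)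
    (u w : CoordSpace n m) : ℝ :=
  ∑ i, coefDiag C γ d x i * sqForm (dx i) u w
    + ∑ α, d (Sum.inr α) (Sum.inr α) * sqForm (nuForm γ x α) u w
    + ∑ i, ∑ j, (if i < j then coefXX C d x i j * symProd (dx i) (dx j) u w else 0)
    + ∑ i, ∑ α, coefXZ C d x i α * symProd (dx i) (dz α) u w
    - (1 / 2) * ∑ i, ∑ l, ∑ p, ∑ α,
        coefXZ C d x i α * γ α p l * x l * symProd (dx i) (dx p) u w
    + ∑ α, ∑ β, (if α < β then
        d (Sum.inr α) (Sum.inr β) * symProd (nuForm γ x α) (nuForm γ x β) u w else 0)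

end ExplicitForm

end

/-! In exponential coordinates the Cartan–Schouten connection of this step-two group is the flat
connection of `ℝⁿ × ℝᵐ`. A left invariant field `y⁺` is affine in the base point, and its derivative
along `x⁺` is `(0, ½ ⟨γ x, y⟩)`. Skewness of `γ` makes the bracket equal to `(0, ⟨γ x, y⟩)`, so this
derivative is `½ [x, y]⁺`. Left invariant fields span every tangent space, so no other connection
satisfies the defining identity on smooth fields (`cov_const_eq_zero` records the case of constant
fields). Parallel metrics are therefore exactly the nondegenerate symmetric forms with constant
coefficients (`SmoothMetric.IsParallel.form_eq`, `constMetric_isParallel`).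

The explicit formula is such a constant form in disguise. With `Γ = gammaApply γ x` one has `dz = ν
+ ½ Γ dx`; expanding in `dx` and `dz` makes every occurrence of `x` cancel, leaving the form with
matrix `d` (`explicitForm_eq_constForm`). -/

/-! ### Matrix algebra: the explicit form as a constant form. -/

theorem Finset.sum_diag_add_sum_lt {ι : Type*} [Fintype ι] [LinearOrder ι] (A : ι → ι → ℝ)
    (hA : ∀ i j, A i j = A j i) (f g : ι → ℝ) :
    ∑ i, A i i * (f i * g i) + ∑ i, ∑ j, (if i < j then A i j * (f i * g j + f j * g i) else 0) =
      ∑ i, ∑ j, f i * A i j * g j := by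
  have h1 : ∀ i j, f i * A i j * g j = (if i = j then A i i * (f i * g i) else 0) +
      ((if i < j then f i * A i j * g j else 0) + (if j < i then f i * A i j * g j else 0)) := by
    intro i j
    rcases lt_trichotomy i j with h | h | h
    · simp [h, h.ne, h.not_gt]
    · subst h; simp; ring
    · simp [h, h.ne', h.not_gt]
  have h2 : ∀ i j, (if i < j then A i j * (f i * g j + f j * g i) else 0) =
      (if i < j then f i * A i j * g j else 0) + (if i < j then f j * A j i * g i else 0) := by
    intro i j
    split_ifs
    · rw [hA j i]; ring
    · simp
  rw [Finset.sum_congr rfl fun i _ ↦ Finset.sum_congr rfl fun j _ ↦ h1 i j,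
    Finset.sum_congr rfl fun i _ ↦ Finset.sum_congr rfl fun j _ ↦ h2 i j]
  simp only [Finset.sum_add_distrib, Finset.sum_ite_eq, Finset.mem_univ, if_true]
  -- Exchanging the indices turns the lower triangle into the second half of each symmetric product.
  rw [Finset.sum_comm (f := fun i j ↦ if j < i then f i * A i j * g j else 0)]

section CoordinateForms

variable {n m : ℕ}

/-- The bilinear form with matrix `d` on the coordinate space. -/
noncomputable def constForm (d : Matrix (Fin n ⊕ Fin m) (Fin n ⊕ Fin m) ℝ) (u w : CoordSpace n m) : ℝ :=
  Sum.elim u.1 u.2 ⬝ᵥ d *ᵥ Sum.elim w.1 w.2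

theorem constForm_eq_blocks (d : Matrix (Fin n ⊕ Fin m) (Fin n ⊕ Fin m) ℝ) (hd : d.IsSymm)
    (u w : CoordSpace n m) : constForm d u w =
      u.1 ⬝ᵥ d.toBlocks₁₁ *ᵥ w.1 + u.1 ⬝ᵥ d.toBlocks₁₂ *ᵥ w.2 + w.1 ⬝ᵥ d.toBlocks₁₂ *ᵥ u.2 +
        u.2 ⬝ᵥ d.toBlocks₂₂ *ᵥ w.2 := by
  have h21 : d.toBlocks₂₁ = d.toBlocks₁₂ᵀ := by
    ext i j; exact hd.apply (Sum.inl j) (Sum.inr i)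
  have h : u.2 ⬝ᵥ d.toBlocks₁₂ᵀ *ᵥ w.1 = w.1 ⬝ᵥ d.toBlocks₁₂ *ᵥ u.2 := by
    rw [Matrix.mulVec_transpose, dotProduct_comm, Matrix.dotProduct_mulVec]
  rw [constForm, ← Matrix.fromBlocks_toBlocks d, Matrix.fromBlocks_mulVec, h21]
  simp only [Matrix.toBlocks_fromBlocks₁₁, Matrix.toBlocks_fromBlocks₁₂,
    Matrix.toBlocks_fromBlocks₂₂, Matrix.dotProduct_block, Sum.elim_comp_inl, Sum.elim_comp_inr, dotProduct_add, h]
  ring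

/-- The matrix `(∑ l, γ^α_{il} x_l)_{α, i}`. -/
noncomputable def gammaApply (γ : Fin m → Matrix (Fin n) (Fin n) ℝ) (x : Fin n → ℝ) :
    Matrix (Fin m) (Fin n) ℝ :=
  Matrix.of fun α i ↦ (γ α *ᵥ x) i

section Coefficients

variable {C : Fin n → Fin n → Fin m → ℝ} {γ : Fin m → Matrix (Fin n) (Fin n) ℝ}

/-- By `hC`, the sum `∑ k, C k i β * x k` is the entry `(β, i)` of `Γ`. The coefficients thereby
become block matrix expressions, and the cancellation can be carried out without indices. -/
theorem coefXZ_eq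
    (hC : ∀ α i j, γ α i j = C j i α) (d : Matrix (Fin n ⊕ Fin m) (Fin n ⊕ Fin m) ℝ) (x : Fin n → ℝ)
    (hd : d.IsSymm) (i : Fin n) (α : Fin m) : coefXZ C d x i α =
    ((1 / 2 : ℝ) • ((gammaApply γ x)ᵀ * d.toBlocks₂₂) + d.toBlocks₁₂) i α := by
  simp only [coefXZ, Matrix.add_apply, Matrix.smul_apply, Matrix.mul_apply, gammaApply,
    Matrix.transpose_apply, Matrix.of_apply, Matrix.mulVec, dotProduct, Matrix.toBlocks₂₂,
    Matrix.toBlocks₁₂, smul_eq_mul, Finset.sum_mul, hC]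
  congr 2
  refine Finset.sum_congr rfl fun β _ ↦ Finset.sum_congr rfl fun k _ ↦ ?_
  rw [hd.apply (Sum.inr β) (Sum.inr α)]; ring

theorem coefXX_eq
    (hC : ∀ α i j, γ α i j = C j i α) (d : Matrix (Fin n ⊕ Fin m) (Fin n ⊕ Fin m) ℝ) (x : Fin n → ℝ)
    (i j : Fin n) : coefXX C d x i j =
    ((1 / 4 : ℝ) • ((gammaApply γ x)ᵀ * d.toBlocks₂₂ * gammaApply γ x) +
      (1 / 2 : ℝ) • (d.toBlocks₁₂ * gammaApply γ x + (d.toBlocks₁₂ * gammaApply γ x)ᵀ) +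
      d.toBlocks₁₁) i j := by
  simp only [coefXX, Matrix.add_apply, Matrix.smul_apply, Matrix.mul_apply, gammaApply,
    Matrix.transpose_apply, Matrix.of_apply, Matrix.mulVec, dotProduct, Matrix.toBlocks₂₂,
    Matrix.toBlocks₁₂, Matrix.toBlocks₁₁, smul_eq_mul, Finset.sum_mul, Finset.mul_sum, hC]
  congr 2
  · rw [Finset.sum_comm]
    refine Finset.sum_congr rfl fun β _ ↦ ?_
    rw [Finset.sum_comm (s := Finset.univ (α := Fin n))]
    refine Finset.sum_congr rfl fun α _ ↦ ?_
    rw [Finset.sum_comm]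
    exact Finset.sum_congr rfl fun p _ ↦ Finset.sum_congr rfl fun l _ ↦ by ring
  · simp only [← Finset.sum_add_distrib, Finset.mul_sum]
    exact Finset.sum_congr rfl fun β _ ↦ Finset.sum_congr rfl fun α _ ↦ by ring

/-- For `i = j` the two linear terms of `coefXX` coincide and absorb the factor `½`. Diagonal and
off-diagonal coefficients thus belong to a single matrix. -/
theorem coefDiag_eq_coefXX
    (hC : ∀ α i j, γ α i j = C j i α) (d : Matrix (Fin n ⊕ Fin m) (Fin n ⊕ Fin m) ℝ) (x : Fin n → ℝ)
    (i : Fin n) : coefDiag C γ d x i = coefXX C d x i i := by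
  simp only [coefDiag, coefXX, hC, Finset.mul_sum]
  congr 2
  refine Finset.sum_congr rfl fun β _ ↦ Finset.sum_congr rfl fun α _ ↦ by ring

theorem coefXX_symm
    (hC : ∀ α i j, γ α i j = C j i α) (d : Matrix (Fin n ⊕ Fin m) (Fin n ⊕ Fin m) ℝ) (x : Fin n → ℝ)
    (hd : d.IsSymm) (i j : Fin n) : coefXX C d x i j = coefXX C d x j i := by
  have h1 : d.toBlocks₁₁ᵀ = d.toBlocks₁₁ := by ext i j; exact hd.apply _ _
  have h2 : d.toBlocks₂₂ᵀ = d.toBlocks₂₂ := by ext i j; exact hd.apply _ _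
  rw [coefXX_eq hC, coefXX_eq hC]
  have h : ∀ M : Matrix (Fin n) (Fin n) ℝ, M = Mᵀ → M i j = M j i := fun M hM ↦ by
    conv_lhs => rw [hM, Matrix.transpose_apply]
  apply h
  simp only [Matrix.transpose_add, Matrix.transpose_smul, Matrix.transpose_mul,
    Matrix.transpose_transpose, h1, h2, Matrix.mul_assoc]
  rw [add_comm (d.toBlocks₁₂ * gammaApply γ x)]

/-- In exponential coordinates the explicit form has constant coefficients. -/
theorem explicitForm_eq_constForm
    (hC : ∀ α i j, γ α i j = C j i α) (d : Matrix (Fin n ⊕ Fin m) (Fin n ⊕ Fin m) ℝ) (x : Fin n → ℝ)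
    (hd : d.IsSymm) (u w : CoordSpace n m) :
    explicitForm C γ d x u w = constForm d u w := by
  have h2 : d.toBlocks₂₂ᵀ = d.toBlocks₂₂ := by ext i j; exact hd.apply _ _
  set Γ := gammaApply γ x with hΓ
  have hν : ∀ u, (fun α ↦ nuForm γ x α u) = u.2 - (1 / 2 : ℝ) • Γ *ᵥ u.1 := by
    intro u; ext α
    simp [nuForm, dz, dx, hΓ, gammaApply, Matrix.mulVec, dotProduct, Finset.sum_mul]
  have hXX : ∑ i, coefDiag C γ d x i * sqForm (dx i) u w +
      ∑ i, ∑ j, (if i < j then coefXX C d x i j * symProd (dx i) (dx j) u w else 0) =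
      u.1 ⬝ᵥ (Matrix.of (coefXX C d x)) *ᵥ w.1 := by
    simp only [coefDiag_eq_coefXX hC]
    refine (Finset.sum_diag_add_sum_lt _ (coefXX_symm hC d x hd) u.1 w.1).trans ?_
    simp [dotProduct, Matrix.mulVec, Finset.mul_sum, mul_assoc]
  have hZZ : ∑ α, d (Sum.inr α) (Sum.inr α) * sqForm (nuForm γ x α) u w +
      ∑ α, ∑ β, (if α < β then
        d (Sum.inr α) (Sum.inr β) * symProd (nuForm γ x α) (nuForm γ x β) u w else 0) =
      (u.2 - (1 / 2 : ℝ) • Γ *ᵥ u.1) ⬝ᵥ d.toBlocks₂₂ *ᵥ (w.2 - (1 / 2 : ℝ) • Γ *ᵥ w.1) := by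
    rw [← hν, ← hν]
    refine (Finset.sum_diag_add_sum_lt (fun α β ↦ d (Sum.inr α) (Sum.inr β))
      (fun α β ↦ hd.apply _ _) (fun α ↦ nuForm γ x α u) (fun α ↦ nuForm γ x α w)).trans ?_
    simp [dotProduct, Matrix.mulVec, Finset.mul_sum, mul_assoc, Matrix.toBlocks₂₂]
  have hXZ : ∑ i, ∑ α, coefXZ C d x i α * symProd (dx i) (dz α) u w =
      u.1 ⬝ᵥ (Matrix.of (coefXZ C d x)) *ᵥ w.2 + w.1 ⬝ᵥ (Matrix.of (coefXZ C d x)) *ᵥ u.2 := by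
    simp only [dotProduct, Matrix.mulVec, Finset.mul_sum, ← Finset.sum_add_distrib, symProd, dx, dz,
      Matrix.of_apply]
    exact Finset.sum_congr rfl fun _ _ ↦ Finset.sum_congr rfl fun _ _ ↦ by ring
  -- With the factor `-½`, this sum combines with `hXZ` to replace `dz` by `ν = dz - ½ Γ dx` in the
  -- mixed terms.
  have hXX' : ∑ i, ∑ l, ∑ p, ∑ α,
        coefXZ C d x i α * γ α p l * x l * symProd (dx i) (dx p) u w =
      u.1 ⬝ᵥ (Matrix.of (coefXZ C d x)) *ᵥ (Γ *ᵥ w.1) +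
        w.1 ⬝ᵥ (Matrix.of (coefXZ C d x)) *ᵥ (Γ *ᵥ u.1) := by
    simp only [dotProduct, Matrix.mulVec, Finset.mul_sum, ← Finset.sum_add_distrib, symProd, dx,
      Matrix.of_apply, hΓ, gammaApply, Finset.sum_mul]
    refine Finset.sum_congr rfl fun i _ ↦ ?_
    rw [Finset.sum_comm, Finset.sum_comm (s := Finset.univ (α := Fin m))]
    refine Finset.sum_congr rfl fun p _ ↦ ?_
    rw [Finset.sum_comm]
    exact Finset.sum_congr rfl fun _ _ ↦ Finset.sum_congr rfl fun _ _ ↦ by ring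
  have e1 : Matrix.of (coefXX C d x) = _ := Matrix.ext (coefXX_eq hC d x)
  have e2 : Matrix.of (coefXZ C d x) = _ := Matrix.ext (coefXZ_eq hC d x hd)
  have hT : ∀ (a : Fin n → ℝ) (b : Fin m → ℝ), a ⬝ᵥ Γᵀ *ᵥ b = b ⬝ᵥ Γ *ᵥ a := fun a b ↦ by
    rw [Matrix.mulVec_transpose, dotProduct_comm, Matrix.dotProduct_mulVec]
  have hP : ∀ (a : Fin m → ℝ) (b : Fin n → ℝ), a ⬝ᵥ d.toBlocks₁₂ᵀ *ᵥ b =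
      b ⬝ᵥ d.toBlocks₁₂ *ᵥ a := fun a b ↦ by
    rw [Matrix.mulVec_transpose, dotProduct_comm, Matrix.dotProduct_mulVec]
  have hM : ∀ a b : Fin m → ℝ, a ⬝ᵥ d.toBlocks₂₂ *ᵥ b = b ⬝ᵥ d.toBlocks₂₂ *ᵥ a := fun a b ↦ by
    conv_lhs => rw [← h2]
    rw [Matrix.mulVec_transpose, dotProduct_comm, Matrix.dotProduct_mulVec]
  have hcomm : ∀ a b : Fin m → ℝ, (d.toBlocks₂₂ *ᵥ a) ⬝ᵥ b = b ⬝ᵥ d.toBlocks₂₂ *ᵥ a :=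
    fun a b ↦ dotProduct_comm _ _
  have hcomm' : ∀ (a : Fin n → ℝ) (b : Fin m → ℝ), (d.toBlocks₁₂ᵀ *ᵥ a) ⬝ᵥ b =
      a ⬝ᵥ d.toBlocks₁₂ *ᵥ b := fun a b ↦ by rw [dotProduct_comm, hP]
  rw [explicitForm, constForm_eq_blocks d hd]
  rw [e1, ← hΓ] at hXX
  rw [e2, ← hΓ] at hXZ hXX'
  simp only [Matrix.add_mulVec, Matrix.smul_mulVec, Matrix.mulVec_sub, Matrix.mulVec_smul,
    dotProduct_add, dotProduct_sub, sub_dotProduct, dotProduct_smul, smul_dotProduct, smul_eq_mul,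
    Matrix.transpose_mul, ← Matrix.mulVec_mulVec, hT, hcomm, hcomm'] at hXX hZZ hXZ hXX'
  -- The terms in `Γᵀ d₂₂ Γ` have weights `¼ + ¼ - ½ = 0`, and those linear in `Γ` cancel in pairs.
  -- Symmetry of `d₂₂`, through `hM`, identifies the terms to be cancelled.
  linarith [hM u.2 (Γ *ᵥ w.1), hM (Γ *ᵥ u.1) (Γ *ᵥ w.1), hM w.2 (Γ *ᵥ u.1), hM u.2 w.2]

end Coefficients

/-! ### Connections and metrics on a vector space. -/

section
variable {E : Type*} [NormedAddCommGroup E] [NormedSpace ℝ E]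

theorem mdifferentiableAt_vectorSpace_iff_differentiableAt
    {W : (x : E) → TangentSpace 𝓘(ℝ, E) x} {x : E} :
    MDifferentiableAt 𝓘(ℝ, E) 𝓘(ℝ, E).tangent
      (fun y ↦ (⟨y, W y⟩ : TangentBundle 𝓘(ℝ, E) E)) x ↔ DifferentiableAt ℝ (E := E) (F := E) W x := by
  rw [mdifferentiableAt_totalSpace]
  simp only [trivializationAt_model_space_apply]
  exact (and_iff_right mdifferentiableAt_id).trans mdifferentiableAt_iff_differentiableAt

/-- The standard flat connection of a vector space. -/
noncomputable def flatConnection (E : Type*) [NormedAddCommGroup E] [NormedSpace ℝ E] :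
    CovariantDerivative 𝓘(ℝ, E) E (fun x : E ↦ TangentSpace 𝓘(ℝ, E) x) where
  toFun W x := fderiv ℝ (E := E) (F := E) W x
  isCovariantDerivativeOnUniv :=
    { add := fun hσ hσ' _ ↦ fderiv_add (mdifferentiableAt_vectorSpace_iff_differentiableAt.1 hσ)
        (mdifferentiableAt_vectorSpace_iff_differentiableAt.1 hσ')
      leibniz := by
        intro σ g x hσ hg _
        have h1 := mdifferentiableAt_vectorSpace_iff_differentiableAt.1 hσ
        have h2 := mdifferentiableAt_iff_differentiableAt.1 hg
        refine (fderiv_smul h2 h1).trans ?_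
        ext v
        simp [mvfderiv]
        rfl}

/-- The tangent trivializations of a vector space are the identity, so reading `f` in bundle
coordinates gives back `f`. -/
theorem contMDiff_bilinear_iff_contDiff {f : E → E →L[ℝ] E →L[ℝ] ℝ} :
    ContMDiff 𝓘(ℝ, E) (𝓘(ℝ, E).prod 𝓘(ℝ, E →L[ℝ] E →L[ℝ] ℝ)) ∞
      (fun p ↦ Bundle.TotalSpace.mk' (E →L[ℝ] E →L[ℝ] ℝ)
        (E := fun q : E ↦ TangentSpace 𝓘(ℝ, E) q →L[ℝ] TangentSpace 𝓘(ℝ, E) q →L[ℝ] ℝ) p (f p)) ↔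
      ContDiff ℝ ∞ f := by
  have hmem : ∀ x y : E, y ∈ (trivializationAt E (TangentSpace 𝓘(ℝ, E)) x).baseSet := fun x y ↦ by
    rw [TangentBundle.trivializationAt_baseSet]; exact Set.mem_univ y
  have hsymm : ∀ x y u : E, (trivializationAt E (TangentSpace 𝓘(ℝ, E)) x).symm y u = u :=
    fun x y u ↦ (Bundle.Trivialization.symmL_apply (R := ℝ) _ (hmem x y) u).symm.trans <| congrArg (fun L : E →L[ℝ] E ↦ L u) (TangentBundle.symmL_model_space (𝕜 := ℝ) x y)
  have hcoord : ∀ x y : E, ContinuousLinearMap.inCoordinates E (TangentSpace 𝓘(ℝ, E))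
      (E →L[ℝ] ℝ) (fun q : E ↦ TangentSpace 𝓘(ℝ, E) q →L[ℝ] ℝ) x y x y (f y) = f y := by
    intro x y
    ext u v
    erw [inCoordinates_apply_eq₂ (F₃ := ℝ) (E₃ := Bundle.Trivial E ℝ) (hmem x y) (hmem x y) (by simp),
      hsymm, hsymm]
    simp
    rfl
  rw [← contMDiff_iff_contDiff]
  refine forall_congr' fun x ↦ ?_
  rw [contMDiffAt_hom_bundle]
  refine (and_iff_right contMDiffAt_id).trans ?_
  exact iff_of_eq (congrArg (fun g ↦ ContMDiffAt 𝓘(ℝ, E) 𝓘(ℝ, E →L[ℝ] E →L[ℝ] ℝ) ∞ g x)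
    (funext fun y ↦ hcoord x y))

/-- The difference of two connections is a tensor, so at `x` it sees only the value `W x`. It is
enough to test one field through each vector `w`. -/
theorem eq_of_flatConnection {cov : CovariantDerivative 𝓘(ℝ, E) E (fun x : E ↦ TangentSpace 𝓘(ℝ, E) x)}
    [FiniteDimensional ℝ E] (x : E)
    (h : ∀ w : E, ∃ W : (x : E) → TangentSpace 𝓘(ℝ, E) x, DifferentiableAt ℝ (E := E) (F := E) W x ∧
      W x = w ∧ cov W x = flatConnection E W x) (W : (x : E) → TangentSpace 𝓘(ℝ, E) x)
      (hW : DifferentiableAt ℝ (E := E) (F := E) W x) :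
      cov W x = flatConnection E W x := by
  have key : ∀ W : (x : E) → TangentSpace 𝓘(ℝ, E) x, DifferentiableAt ℝ (E := E) (F := E) W x →
      cov.difference (flatConnection E) x (W x) = cov W x - flatConnection E W x := fun W hW ↦
    IsCovariantDerivativeOn.difference_apply _ _ (Set.mem_univ x)
      (mdifferentiableAt_vectorSpace_iff_differentiableAt.2 hW)
  obtain ⟨W', hW', h1, h2⟩ := h (W x)
  rw [← sub_eq_zero, ← key W hW, ← h1, key W' hW', h2, sub_self]
/-- The metric with constant coefficients on a vector space. -/
noncomputable def constMetric (f : E →L[ℝ] E →L[ℝ] ℝ) (hs : ∀ u v, f u v = f v u)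
    (hn : ∀ u, (∀ v, f u v = 0) → u = 0) : SmoothMetric 𝓘(ℝ, E) E where
  form _ := f
  symm _ := hs
  nondegenerate _ := hn
  contMDiff := contMDiff_bilinear_iff_contDiff.2 contDiff_const

theorem constMetric_isParallel (f : E →L[ℝ] E →L[ℝ] ℝ) (hs : ∀ u v, f u v = f v u)
    (hn : ∀ u, (∀ v, f u v = 0) → u = 0) : (constMetric f hs hn).IsParallel (flatConnection E) := by
  intro Y Z hY hZ p v
  have h1 : HasFDerivAt (F := E) Y (fderiv ℝ (F := E) Y p) p :=
    ((contMDiff_vectorSpace_iff_contDiff.1 hY).differentiable (by simp) p).hasFDerivAt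
  have h2 : HasFDerivAt (F := E) Z (fderiv ℝ (F := E) Z p) p :=
    ((contMDiff_vectorSpace_iff_contDiff.1 hZ).differentiable (by simp) p).hasFDerivAt
  have h3 := (f.hasFDerivAt_of_bilinear h1 h2).fderiv
  have h4 : fderiv ℝ (fun q : E ↦ f (Y q) (Z q)) p v =
      f (fderiv ℝ (F := E) Y p v) (Z p) + f (Y p) (fderiv ℝ (F := E) Z p v) := by
    rw [h3]
    exact add_comm _ _
  exact (congrArg (fun L : E →L[ℝ] ℝ ↦ L v) mfderiv_eq_fderiv).trans h4

/-- A metric is constant as soon as the constant vector fields are parallel for a connection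
preserving it. -/
theorem SmoothMetric.IsParallel.form_eq {μ : SmoothMetric 𝓘(ℝ, E) E}
    {cov : CovariantDerivative 𝓘(ℝ, E) E (fun x : E ↦ TangentSpace 𝓘(ℝ, E) x)}
    (hμ : μ.IsParallel cov)
    (hcov : ∀ u x : E, cov (fun _ ↦ u) x = 0) (p q u w : E) :
    (μ.form p : E →L[ℝ] E →L[ℝ] ℝ) u w = (μ.form q : E →L[ℝ] E →L[ℝ] ℝ) u w := by
  let f : E → E →L[ℝ] E →L[ℝ] ℝ := fun p ↦ μ.form p
  have hf : ContDiff ℝ ∞ f := contMDiff_bilinear_iff_contDiff.1 μ.contMDiff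
  have hd : Differentiable ℝ (fun p ↦ f p u w) :=
    ((hf.clm_apply contDiff_const).clm_apply contDiff_const).differentiable (by simp)
  have hc : ∀ u : E, ContMDiff 𝓘(ℝ, E) 𝓘(ℝ, E).tangent ∞
      (fun y ↦ (⟨y, u⟩ : TangentBundle 𝓘(ℝ, E) E)) := fun u ↦
    contMDiff_vectorSpace_iff_contDiff.2 contDiff_const
  refine is_const_of_fderiv_eq_zero (𝕜 := ℝ) hd (fun p ↦ ?_) p q
  ext v
  -- On constant fields both terms on the right of the parallelism identity vanish, so the
  -- coefficient `μ(u, w)` has zero derivative.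
  have h := hμ (fun _ ↦ u) (fun _ ↦ w) (hc u) (hc w) p v
  rw [hcov u p, hcov w p] at h
  refine (congrArg (fun L : E →L[ℝ] ℝ ↦ L v) mfderiv_eq_fderiv).symm.trans (h.trans ?_)
  have h0 : (μ.form p) 0 = 0 := map_zero _
  have h1 : (μ.form p u) 0 = 0 := map_zero _
  refine (congrArg₂ (fun a b : ℝ ↦ a + b) (congrArg (fun L : E →L[ℝ] ℝ ↦ L w) h0) h1).trans ?_
  exact add_zero (0 : ℝ)
end

/-! ### Flatness of the Cartan–Schouten connection in exponential coordinates. -/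

namespace ExpGroup
variable {n m : ℕ} {γ : Fin m → Matrix (Fin n) (Fin n) ℝ}

theorem pairing_swap (hγ : ∀ k, (γ k)ᵀ = -γ k) (x y : Fin n → ℝ) :
    pairing γ y x = -pairing γ x y := by
  ext k
  rw [pairing, Pi.neg_apply, pairing, Finset.sum_comm, ← Finset.sum_neg_distrib]
  refine Finset.sum_congr rfl fun i _ ↦ ?_
  rw [← Finset.sum_neg_distrib]
  refine Finset.sum_congr rfl fun l _ ↦ ?_
  have := congrFun (congrFun (hγ k) i) l
  simp only [Matrix.transpose_apply, Matrix.neg_apply] at this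
  rw [this]; ring

/-- The left invariant vector fields, as maps of the coordinate space. -/
noncomputable def leftField (γ : Fin m → Matrix (Fin n) (Fin n) ℝ) (u p : CoordSpace n m) : CoordSpace n m :=
  (u.1, u.2 + (1 / 2 : ℝ) • pairing γ p.1 u.1)

theorem differentiable_leftField (u : CoordSpace n m) : Differentiable ℝ (leftField γ u) := by
  unfold leftField pairing
  fun_prop

/-- The field is affine in the base point, so its derivative does not depend on `p`. -/
theorem fderiv_leftField (u p v : CoordSpace n m) :
    fderiv ℝ (leftField γ u) p v = (0, (1 / 2 : ℝ) • pairing γ v.1 u.1) := by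
  rw [← (differentiable_leftField u p).lineDeriv_eq_fderiv]
  apply HasLineDerivAt.lineDeriv
  have h : ∀ t : ℝ, leftField γ u (p + t • v) = leftField γ u p +
      t • ((0, (1 / 2 : ℝ) • pairing γ v.1 u.1) : CoordSpace n m) := by
    intro t
    refine Prod.ext ?_ ?_
    · simp [leftField]
    · simp only [leftField, Prod.fst_add, Prod.smul_fst, Prod.smul_snd, pairing_add_left,
        pairing_smul_left, Prod.snd_add, smul_add, smul_comm t (1 / 2 : ℝ), add_assoc]
  unfold HasLineDerivAt
  simp only [h]
  simpa using ((hasDerivAt_id (0 : ℝ)).smul_const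
    ((0, (1 / 2 : ℝ) • pairing γ v.1 u.1) : CoordSpace n m)).const_add (leftField γ u p)

theorem mulInvariantVectorField_eq_leftField (u : CoordSpace n m) :
    (mulInvariantVectorField (I := 𝓘(ℝ, CoordSpace n m)) (G := ExpGroup γ) u :
      CoordSpace n m → CoordSpace n m) = leftField γ u :=
  funext fun p ↦ mulInvariantVectorField_eq u p

theorem exists_leftField_eq (p w : CoordSpace n m) : ∃ u, leftField γ u p = w :=
  ⟨(w.1, w.2 - (1 / 2 : ℝ) • pairing γ p.1 w.1), by simp [leftField]⟩

/-- Skewness merges the two halves of the bracket into one `pairing`. The bracket has no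
`x`-component, so its left invariant field is constant. -/
theorem half_smul_leftField_bracket (hγ : ∀ k, (γ k)ᵀ = -γ k)
    (x y : GroupLieAlgebra 𝓘(ℝ, CoordSpace n m) (ExpGroup γ)) (p : CoordSpace n m) :
    (1 / 2 : ℝ) • leftField γ (tcoord ⁅x, y⁆) p =
      fderiv ℝ (leftField γ (tcoord y)) p (leftField γ (tcoord x) p) := by
  have h0 : pairing γ p.1 0 = 0 := by simpa using pairing_smul_right (γ := γ) 0 p.1 0
  rw [bracket_eq, fderiv_leftField]
  rw [pairing_swap hγ (tcoord x).1 (tcoord y).1]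
  refine Prod.ext ?_ ?_
  · simp [leftField]
  · simp only [leftField, h0, Prod.smul_snd, smul_zero, add_zero, sub_neg_eq_add]
    module

/-- The standard flat connection of the coordinate space, as a connection on the group. -/
noncomputable def connection (γ : Fin m → Matrix (Fin n) (Fin n) ℝ) :
    CovariantDerivative 𝓘(ℝ, CoordSpace n m) (CoordSpace n m)
      (fun p : ExpGroup γ ↦ TangentSpace 𝓘(ℝ, CoordSpace n m) p) :=
  flatConnection (CoordSpace n m)

/-- In exponential coordinates the Cartan–Schouten connection is the standard flat connection. -/
theorem isCartanSchoutenConnection_connection (hγ : ∀ k, (γ k)ᵀ = -γ k) :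
    IsCartanSchoutenConnection (connection γ) := by
  intro x y g
  refine Eq.trans ?_ ((half_smul_leftField_bracket hγ x y g).symm.trans ?_)
  · exact congrArg₂ (fun (F : CoordSpace n m → CoordSpace n m) (v : CoordSpace n m) ↦
      fderiv ℝ F g v) (mulInvariantVectorField_eq_leftField (γ := γ) y)
      (mulInvariantVectorField_eq (γ := γ) x g)
  · exact congrArg (fun v : CoordSpace n m ↦ (1 / 2 : ℝ) • v)
      (mulInvariantVectorField_eq (γ := γ) _ g).symm

/-- Any Cartan–Schouten connection agrees with the flat one on left invariant fields. These take
every value at `p`, so tensoriality of the difference extends the agreement to constant fields. -/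
theorem cov_const_eq_zero (hγ : ∀ k, (γ k)ᵀ = -γ k)
    {cov : CovariantDerivative 𝓘(ℝ, CoordSpace n m) (CoordSpace n m)
      (fun p : ExpGroup γ ↦ TangentSpace 𝓘(ℝ, CoordSpace n m) p)}
    (hcov : IsCartanSchoutenConnection cov) (u p : CoordSpace n m) :
    (cov (fun _ ↦ (u : CoordSpace n m)) p : CoordSpace n m →L[ℝ] CoordSpace n m) = 0 := by
  refine (eq_of_flatConnection (cov := cov) p (fun w ↦ ?_) (fun _ ↦ u) (differentiableAt_const _)).trans
    (fderiv_const_apply (𝕜 := ℝ) u)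
  obtain ⟨y, hy⟩ := exists_leftField_eq (γ := γ) p w
  refine ⟨leftField γ y, differentiable_leftField y p, hy, ContinuousLinearMap.ext fun v ↦ ?_⟩
  obtain ⟨x, rfl⟩ := exists_leftField_eq (γ := γ) p v
  have h := (hcov x y p).trans (isCartanSchoutenConnection_connection hγ x y p).symm
  have h1 := mulInvariantVectorField_eq_leftField (γ := γ) y
  have h2 := mulInvariantVectorField_eq (γ := γ) x p
  -- The group and its coordinate space agree only by unfolding; `key` passes from
  -- `mulInvariantVectorField` to `leftField` by substitution.
  have key : ∀ F F' v v', F = F' → v = v' → (cov F p : CoordSpace n m →L[ℝ] CoordSpace n m) v =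
      (flatConnection (CoordSpace n m) F p : CoordSpace n m →L[ℝ] CoordSpace n m) v →
      (cov F' p : CoordSpace n m →L[ℝ] CoordSpace n m) v' =
      (flatConnection (CoordSpace n m) F' p : CoordSpace n m →L[ℝ] CoordSpace n m) v' := by
    rintro F _ v _ rfl rfl h
    exact h
  exact key _ _ _ _ h1 h2 h

end ExpGroup

/-! ### Constant bilinear forms and their matrices. -/

/-- `constForm d` as a continuous bilinear map. -/
noncomputable def constFormL (d : Matrix (Fin n ⊕ Fin m) (Fin n ⊕ Fin m) ℝ) :
    CoordSpace n m →L[ℝ] CoordSpace n m →L[ℝ] ℝ :=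
  ((LinearMap.BilinForm.congr (LinearEquiv.sumArrowLequivProdArrow (Fin n) (Fin m) ℝ ℝ))
    (Matrix.toBilin' d)).toContinuousBilinearMap

theorem constFormL_apply (d : Matrix (Fin n ⊕ Fin m) (Fin n ⊕ Fin m) ℝ) (u w : CoordSpace n m) :
    constFormL d u w = constForm d u w := by
  refine (Matrix.toBilin'_apply' d _ _).trans ?_
  rfl

theorem constForm_comm (d : Matrix (Fin n ⊕ Fin m) (Fin n ⊕ Fin m) ℝ) (hd : d.IsSymm)
    (u w : CoordSpace n m) : constForm d u w = constForm d w u := by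
  rw [constForm, constForm]
  nth_rewrite 1 [← hd.eq]
  rw [Matrix.mulVec_transpose, dotProduct_comm, Matrix.dotProduct_mulVec]

theorem eq_zero_of_constForm_eq_zero {d : Matrix (Fin n ⊕ Fin m) (Fin n ⊕ Fin m) ℝ}
    (hd : d.IsSymm) (hdet : d.det ≠ 0) (u : CoordSpace n m) (hu : ∀ w, constForm d u w = 0) :
    u = 0 := by
  have h : d *ᵥ Sum.elim u.1 u.2 = 0 := by
    ext a
    -- Pairing with the coordinate vector of index `a` reads off entry `a` of `d` applied to `u`.
    have h1 := hu (fun i ↦ Pi.single (M := fun _ ↦ ℝ) a 1 (Sum.inl i),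
      fun k ↦ Pi.single (M := fun _ ↦ ℝ) a 1 (Sum.inr k))
    rw [constForm_comm d hd] at h1
    have h2 : Sum.elim (fun i ↦ Pi.single (M := fun _ ↦ ℝ) a 1 (Sum.inl i : Fin n ⊕ Fin m))
        (fun k ↦ Pi.single (M := fun _ ↦ ℝ) a 1 (Sum.inr k : Fin n ⊕ Fin m)) = Pi.single a 1 := by
      ext (i | i) <;> rfl
    simpa [constForm, h2] using h1
  have h3 := Matrix.eq_zero_of_mulVec_eq_zero hdet h
  exact Prod.ext (funext fun i ↦ congrFun h3 (Sum.inl i)) (funext fun i ↦ congrFun h3 (Sum.inr i))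

/-- The coordinate basis of the coordinate space. -/
noncomputable def coordBasis (n m : ℕ) : Module.Basis (Fin n ⊕ Fin m) ℝ (CoordSpace n m) :=
  (Pi.basisFun ℝ (Fin n)).prod (Pi.basisFun ℝ (Fin m))

/-- Every bilinear form on the coordinate space is given by its matrix of coefficients. -/
theorem exists_eq_constForm (f : CoordSpace n m →L[ℝ] CoordSpace n m →L[ℝ] ℝ)
    (hs : ∀ u v, f u v = f v u) (hn : ∀ u, (∀ v, f u v = 0) → u = 0) :
    ∃ d : Matrix (Fin n ⊕ Fin m) (Fin n ⊕ Fin m) ℝ, d.IsSymm ∧ d.det ≠ 0 ∧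
      ∀ u w, f u w = constForm d u w := by
  let b := coordBasis n m
  have hb : ∀ u : CoordSpace n m, ∑ a, Sum.elim u.1 u.2 a • b a = u := fun u ↦ by
    conv_rhs => rw [← b.sum_repr u]
    refine Finset.sum_congr rfl fun a _ ↦ ?_
    rcases a with a | a <;> simp [b, coordBasis]
  have hf : ∀ u w, f u w = constForm (Matrix.of fun a c ↦ f (b a) (b c)) u w := by
    intro u w
    conv_lhs => rw [← hb u, ← hb w]
    simp [constForm, dotProduct, Matrix.mulVec, Finset.mul_sum, -Fintype.sum_sum_type]
    rw [Finset.sum_comm]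
    exact Finset.sum_congr rfl fun _ _ ↦ Finset.sum_congr rfl fun _ _ ↦ by ring
  have hd : (Matrix.of fun a c ↦ f (b a) (b c)).IsSymm := Matrix.IsSymm.ext fun a c ↦ hs _ _
  refine ⟨_, hd, fun h0 ↦ ?_, hf⟩
  -- A kernel vector of the Gram matrix pairs to zero with everything, contradicting nondegeneracy.
  obtain ⟨v, hv, hv0⟩ := Matrix.exists_mulVec_eq_zero_iff.2 h0
  let u : CoordSpace n m := (fun i ↦ v (Sum.inl i), fun k ↦ v (Sum.inr k))
  have hu : Sum.elim u.1 u.2 = v := by ext (i | i) <;> rfl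
  have h := hn u fun w ↦ by rw [hs, hf, constForm, hu, hv0, dotProduct_zero]
  apply hv
  rw [← hu, h]
  ext (i | i) <;> rfl

end CoordinateForms

/-! ### Structure constants and the final assembly. -/

theorem structConst_swap {𝔤 : Type*} [LieRing 𝔤] [LieAlgebra ℝ 𝔤] {n m : ℕ}
    (b : Module.Basis (Fin n ⊕ Fin m) ℝ 𝔤) (i j : Fin n) (k : Fin m) :
    structConst b j i k = -structConst b i j k := by
  unfold structConst
  rw [← lie_skew (b (Sum.inl j)) (b (Sum.inl i)), map_neg, Finsupp.neg_apply]

theorem gammaMat_apply_eq_structConst {𝔤 : Type*} [LieRing 𝔤] [LieAlgebra ℝ 𝔤] {n m : ℕ}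
    (b : Module.Basis (Fin n ⊕ Fin m) ℝ 𝔤) (k : Fin m) (i j : Fin n) :
    gammaMat b k i j = structConst b j i k := by
  rw [structConst_swap b i j]; rfl

theorem gammaMat_transpose {𝔤 : Type*} [LieRing 𝔤] [LieAlgebra ℝ 𝔤] {n m : ℕ}
    (b : Module.Basis (Fin n ⊕ Fin m) ℝ 𝔤) (k : Fin m) : (gammaMat b k)ᵀ = -gammaMat b k := by
  ext i j
  simp [gammaMat, structConst_swap b i j]

theorem mainTheorem9 {𝔤 : Type*} [LieRing 𝔤] [LieAlgebra ℝ 𝔤] (n m : ℕ)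
    (B : LinearMap.BilinForm ℝ 𝔤) (V Z : Submodule ℝ 𝔤) (hH : IsHType B V Z)
    (b : Module.Basis (Fin n ⊕ Fin m) ℝ 𝔤)
    (hV : ∀ i, b (Sum.inl i) ∈ V) (hZ : ∀ k, b (Sum.inr k) ∈ Z) :
    (∀ μ : SmoothMetric 𝓘(ℝ, CoordSpace n m) (ExpGroup (gammaMat b)), μ.IsCartanSchouten →
      (∃ d : Matrix (Fin n ⊕ Fin m) (Fin n ⊕ Fin m) ℝ, d.IsSymm ∧ d.det ≠ 0 ∧
        ∀ (p : ExpGroup (gammaMat b)) (u w : TangentSpace 𝓘(ℝ, CoordSpace n m) p),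
          μ.form p u w = explicitForm (structConst b) (gammaMat b) d p.coord.1
            (ExpGroup.tcoord u) (ExpGroup.tcoord w)) ∧
      (∀ u w : CoordSpace n m, ∃ P : MvPolynomial (Fin n) ℝ, P.totalDegree ≤ 2 ∧
        ∀ p : ExpGroup (gammaMat b),
          μ.form p (u : TangentSpace 𝓘(ℝ, CoordSpace n m) p)
            (w : TangentSpace 𝓘(ℝ, CoordSpace n m) p) = MvPolynomial.eval p.coord.1 P)) ∧
    (∀ d : Matrix (Fin n ⊕ Fin m) (Fin n ⊕ Fin m) ℝ, d.IsSymm → d.det ≠ 0 →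
      ∃ μ : SmoothMetric 𝓘(ℝ, CoordSpace n m) (ExpGroup (gammaMat b)), μ.IsCartanSchouten ∧
        ∀ (p : ExpGroup (gammaMat b)) (u w : TangentSpace 𝓘(ℝ, CoordSpace n m) p),
          μ.form p u w = explicitForm (structConst b) (gammaMat b) d p.coord.1
            (ExpGroup.tcoord u) (ExpGroup.tcoord w)) := by

  have hγ := gammaMat_transpose b
  have hC : ∀ α i j, gammaMat b α i j = structConst b j i α := gammaMat_apply_eq_structConst b
  refine ⟨?_, ?_⟩
  -- The metric is reread on the underlying vector space, where the constancy result applies.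
  · rintro (μ : SmoothMetric 𝓘(ℝ, CoordSpace n m) (CoordSpace n m)) ⟨cov, hcov, hμ⟩
    have hconst := SmoothMetric.IsParallel.form_eq (μ := μ) (cov := cov) hμ
      (ExpGroup.cov_const_eq_zero hγ hcov)
    obtain ⟨d, hd, hdet, hf⟩ := exists_eq_constForm (μ.form 0) (μ.symm 0) (μ.nondegenerate 0)
    -- The matrix `d` is that of `μ` at the unit. The components are constant, so a polynomial of
    -- degree `0` meets the bound `2`.
    refine ⟨⟨d, hd, hdet, fun p u w ↦ ?_⟩, fun u w ↦
      ⟨MvPolynomial.C (constForm d u w), by simp, fun p ↦ ?_⟩⟩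
    · rw [explicitForm_eq_constForm hC d _ hd]
      exact (hconst p 0 u w).trans (hf u w)
    · rw [MvPolynomial.eval_C]
      exact (hconst p 0 u w).trans (hf u w)
  · intro d hd hdet
    refine ⟨constMetric (constFormL d)
      (fun u v ↦ by rw [constFormL_apply, constFormL_apply, constForm_comm d hd])
      (fun u hu ↦ eq_zero_of_constForm_eq_zero hd hdet u fun w ↦ by
        rw [← constFormL_apply]; exact hu w),
      ⟨ExpGroup.connection _, ExpGroup.isCartanSchoutenConnection_connection hγ,
        constMetric_isParallel _ _ _⟩, fun p u w ↦ ?_⟩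
    rw [explicitForm_eq_constForm hC d _ hd]
    exact constFormL_apply d u w
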